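/- Let $\Gamma=(V,E)$ be a finite simple graph. A matching $M\subseteq E$ is a set of pairwise vertex-disjoint edges; it is called positive in $\Gamma$ if there is a function $w\colon V\to\mathbb{R}$ such that, for every edge $uv\in E$, $w(u)+w(v)>0$ if and only if $uv\in M$. A positive matching decomposition of $\Gamma$ with $p$ parts is an ordered partition $E_1,\ldots,E_p$ of $E$ such that, for each $i=1,\ldots,p$, $E_i$ is a positive matching of the graph $\bigl(V,\,E\setminus\bigcup_{j=1}^{i-1}E_j\bigr)$. Let $\mathrm{pmd}(\Gamma)$ be the smallest $p$ for which $\Gamma$ has a positive matching decomposition with $p$ parts. Let $C_n$ denote the cycle on $n$ vertices and $\square$ the Cartesian product of graphs. For all integers $m,n\geq3$, \[5\leq\mathrm{pmd}(C_m\,\square\, C_n)\leq6.\] In addition, $\mathrm{pmd}(C_m\,\square\, C_n)=5$ if $m+n$ is odd and $\{m,n\}$ is none of $\{3,4\}$, $\{3,6\}$, $\{5,6\}$. -/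

import Mathlib

namespace SimpleGraph

/-- A set `M` of edges of `G` is a matching: distinct members share no vertex. -/
def IsEdgeMatching {V : Type*} (G : SimpleGraph V) (M : Set (Sym2 V)) : Prop :=
  M ⊆ G.edgeSet ∧ ∀ e ∈ M, ∀ f ∈ M, e ≠ f → ∀ v : V, ¬ (v ∈ e ∧ v ∈ f)

/-- A matching `M` of `G` is positive if some real vertex weighting makes the edges of `G` that
lie in `M` exactly those of positive weight, the weight of `uv` being `w u + w v`. -/
def IsPositiveMatching {V : Type*} (G : SimpleGraph V) (M : Set (Sym2 V)) : Prop :=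
  G.IsEdgeMatching M ∧
    ∃ w : V → ℝ, ∀ u v : V, G.Adj u v → (0 < w u + w v ↔ s(u, v) ∈ M)

/-- `E 0, …, E (p - 1)` is a positive matching decomposition of `G`: an ordered partition of the
edge set such that each `E i` is a positive matching of `G` with the earlier parts removed. -/
structure IsPMD {V : Type*} (G : SimpleGraph V) {p : ℕ} (E : Fin p → Set (Sym2 V)) : Prop where
  nonempty : ∀ i, (E i).Nonempty
  disjoint : ∀ i j, i ≠ j → Disjoint (E i) (E j)
  iUnion_eq : ⋃ i, E i = G.edgeSet
  positive : ∀ i, (G.deleteEdges (⋃ (j : Fin p) (_ : j < i), E j)).IsPositiveMatching (E i)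

/-- The smallest number of parts of a positive matching decomposition of `G`. (A finite graph
always has one, with every part a single edge, so that the infimum is then a minimum.) -/
noncomputable def pmd {V : Type*} (G : SimpleGraph V) : ℕ :=
  sInf {p : ℕ | ∃ E : Fin p → Set (Sym2 V), G.IsPMD E}

end SimpleGraph

/-!
The lower bound is a weight count valid in every `d`-regular graph with `2 ≤ d`. If `w` witnesses
that a *perfect* matching `M` is positive, then the total weight `∑ w v` is positive, being the sum
over `M` of the edge weights; but the edges outside `M` have total weight `(d - 1) * ∑ w v`, which
must be at most zero. Hence the first part of a positive matching decomposition misses a vertex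
(`IsPositiveMatching.exists_not_covered`), so that `d` parts, each with at most half as many edges
as there are vertices, cannot exhaust the edge set (`IsPMD.degree_lt`). The torus `C_m □ C_n` is
`4`-regular.

For the upper bounds, a decomposition is presented as a colouring of the edges together with a
weight function for each colour (`isPMD_of_arcColouring`). As the weights are given, all conditions
are local: they concern one edge, or two edges with a common vertex. A finite table of colours and
weights can therefore be pulled back to the torus along a pair of closed walks of lengths `m` and
`n`, provided that the conditions hold along all arcs of the digraphs walked on
(`exists_isPMD_of_torusTable`). The digraphs used are paths with a few returning arcs, in which
the lengths of closed walks are easy to control (`exists_closedWalk_returnArc`). Two explicit tables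
suffice: one with six colours for all `m, n ≥ 3`, and one with five colours for a pair of an odd
and an even length.
-/

namespace SimpleGraph

/-! ### Decompositions from coloured arcs -/

/-- A positive matching decomposition from a proper edge colouring `c` in `k` ordered colours, each
with a weight function `w i` that is positive on the edges of colour `i` and nonpositive on those of
later colours. The edges are enumerated without repetition by the type `D`. -/
theorem isPMD_of_arcColouring {V D : Type*} (G : SimpleGraph V) {k : ℕ} (e : D → Sym2 V)
    (he : Function.Injective e) (hr : Set.range e = G.edgeSet) (c : D → Fin k)
    (hc : Function.Surjective c)
    (hproper : ∀ d d', d ≠ d' → c d = c d' → ∀ v, ¬ (v ∈ e d ∧ v ∈ e d'))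
    (w : Fin k → V → ℝ)
    (hpos : ∀ d u v, e d = s(u, v) → 0 < w (c d) u + w (c d) v)
    (hneg : ∀ d u v i, e d = s(u, v) → i < c d → w i u + w i v ≤ 0) :
    G.IsPMD (fun i => e '' (c ⁻¹' {i})) where
  nonempty i := by
    obtain ⟨d, hd⟩ := hc i
    exact ⟨e d, d, hd, rfl⟩
  disjoint i j hij := by
    rw [Set.disjoint_image_iff he]
    exact Disjoint.preimage _ (by simpa using hij)
  iUnion_eq := by
    have huniv : ⋃ i, c ⁻¹' {i} = Set.univ := by ext d; simp
    rw [← Set.image_iUnion, huniv, Set.image_univ, hr]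
  positive i := by
    -- What is left before step `i` are the edges of colour at least `i`.
    have hleft : ∀ d, e d ∈ (⋃ (j : Fin k) (_ : j < i), e '' (c ⁻¹' {j})) ↔ c d < i := by
      intro d
      simp only [Set.mem_iUnion, he.mem_set_image, Set.mem_preimage, Set.mem_singleton_iff,
        exists_prop]
      exact ⟨fun ⟨j, hj, h⟩ => h ▸ hj, fun h => ⟨_, h, rfl⟩⟩
    refine ⟨⟨?_, ?_⟩, w i, ?_⟩
    · rintro _ ⟨d, hd, rfl⟩
      rw [edgeSet_deleteEdges, ← hr]
      refine ⟨⟨d, rfl⟩, ?_⟩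
      rw [hleft, show c d = i from hd]
      exact lt_irrefl i
    · rintro _ ⟨d, hd, rfl⟩ _ ⟨d', hd', rfl⟩ hne
      exact hproper d d' (fun h => hne (h ▸ rfl)) (hd.trans hd'.symm)
    · intro u v huv
      rw [deleteEdges_adj] at huv
      obtain ⟨hadj, hle⟩ := huv
      obtain ⟨d, hd⟩ : s(u, v) ∈ Set.range e := hr ▸ hadj
      rw [← hd, hleft, not_lt] at hle
      rw [← hd, he.mem_set_image, Set.mem_preimage, Set.mem_singleton_iff]
      constructor
      · intro h
        by_contra hne
        exact absurd (hneg d u v i hd (lt_of_le_of_ne hle (Ne.symm hne))) (not_le.2 h)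
      · rintro rfl
        exact hpos d u v hd

/-! ### Decompositions of regular graphs -/

theorem IsEdgeMatching.two_mul_card_eq {V : Type*} [Fintype V] [DecidableEq V]
    {G : SimpleGraph V} {M : Finset (Sym2 V)} (hM : G.IsEdgeMatching (M : Set (Sym2 V))) :
    2 * M.card = (Finset.univ.filter fun v => ∃ e ∈ M, v ∈ e).card := by
  have hfil : (Finset.univ.filter fun v => ∃ e ∈ M, v ∈ e) = M.biUnion Sym2.toFinset := by
    ext v; simp [Sym2.mem_toFinset]
  rw [hfil, Finset.card_biUnion]
  · rw [Finset.sum_congr rfl (g := fun _ => 2), Finset.sum_const, smul_eq_mul, mul_comm]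
    intro e he
    exact Sym2.card_toFinset_of_not_isDiag _ (G.not_isDiag_of_mem_edgeSet (hM.1 he))
  · intro e he f hf hne
    rw [Function.onFun, Finset.disjoint_left]
    intro v hv hv'
    exact hM.2 e he f hf hne v ⟨Sym2.mem_toFinset.1 hv, Sym2.mem_toFinset.1 hv'⟩

/-- A positive matching of a `d`-regular graph with `2 ≤ d` is not perfect. -/
theorem IsPositiveMatching.exists_not_covered {V : Type*} [Fintype V] [Nonempty V]
    {G : SimpleGraph V} [DecidableRel G.Adj] {d : ℕ} (hd : 2 ≤ d)
    (hG : G.IsRegularOfDegree d) {M : Set (Sym2 V)} (hM : G.IsPositiveMatching M) :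
    ∃ v, ∀ e ∈ M, v ∉ e := by
  classical
  by_contra! hcov
  obtain ⟨⟨hsub, hmat⟩, w, hw⟩ := hM
  have hpartner : ∀ v, ∃ u, s(v, u) ∈ M := by
    intro v
    obtain ⟨e, he, hv⟩ := hcov v
    obtain ⟨u, rfl⟩ := hv
    exact ⟨u, he⟩
  -- `f` sends each vertex to its partner in the matching.
  choose f hf using hpartner
  have huniq : ∀ v u, s(v, u) ∈ M → u = f v := by
    intro v u h
    by_contra hne
    refine hmat _ h _ (hf v) (fun h' => hne (Sym2.congr_right.1 h')) v ⟨by simp, by simp⟩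
  have hinv : Function.Involutive f := fun v =>
    (huniq (f v) v (by rw [Sym2.eq_swap]; exact hf v)).symm
  have hadj : ∀ v, G.Adj v (f v) := fun v => hsub (hf v)
  have hsum : ∑ v, w (f v) = ∑ v, w v := hinv.bijective.sum_comp w
  have hpos : 0 < ∑ v, w v := by
    have h : 0 < ∑ v, (w v + w (f v)) :=
      Finset.sum_pos (fun v _ => (hw v (f v) (hadj v)).2 (hf v)) Finset.univ_nonempty
    rw [Finset.sum_add_distrib, hsum] at h
    linarith
  -- Around each vertex, only the matching edge has positive weight.
  have hle : ∑ v, ∑ u ∈ G.neighborFinset v, (w v + w u) ≤ ∑ v, (w v + w (f v)) := by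
    refine Finset.sum_le_sum fun v _ => ?_
    rw [← Finset.add_sum_erase _ _ ((G.mem_neighborFinset v (f v)).2 (hadj v))]
    refine add_le_of_nonpos_right (Finset.sum_nonpos fun u hu => ?_)
    rw [Finset.mem_erase, mem_neighborFinset] at hu
    exact not_lt.1 fun h => hu.1 (huniq v u ((hw v u hu.2).1 h))
  have hswap : ∑ v, ∑ u ∈ G.neighborFinset v, w u = ∑ v, (d : ℝ) * w v := by
    rw [Finset.sum_comm' (t' := Finset.univ) (s' := fun u => G.neighborFinset u)
      (by intro v u; simp [G.adj_comm])]
    refine Finset.sum_congr rfl fun v _ => ?_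
    rw [Finset.sum_const, card_neighborFinset_eq_degree, hG v, nsmul_eq_mul]
  have hconst : ∑ v, ∑ u ∈ G.neighborFinset v, w v = ∑ v, (d : ℝ) * w v := by
    refine Finset.sum_congr rfl fun v _ => ?_
    rw [Finset.sum_const, card_neighborFinset_eq_degree, hG v, nsmul_eq_mul]
  -- The sum over all ordered adjacent pairs is `2 * d * ∑ w v`, that over the matching `2 * ∑ w v`.
  simp only [Finset.sum_add_distrib, hswap, hconst, hsum, ← Finset.mul_sum] at hle
  have hd' : (2 : ℝ) ≤ d := by exact_mod_cast hd
  nlinarith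

theorem IsPMD.degree_lt {V : Type*} [Fintype V] [Nonempty V]
    {G : SimpleGraph V} [DecidableRel G.Adj] {d : ℕ} (hd : 2 ≤ d)
    (hG : G.IsRegularOfDegree d) {p : ℕ} {E : Fin p → Set (Sym2 V)} (hE : G.IsPMD E) : d < p := by
  classical
  by_contra! hpd
  have hmatch : ∀ i, G.IsEdgeMatching ((E i).toFinset : Set (Sym2 V)) := by
    intro i
    rw [Set.coe_toFinset]
    refine ⟨?_, (hE.positive i).1.2⟩
    rw [← hE.iUnion_eq]
    exact Set.subset_iUnion E i
  have hcard : G.edgeFinset.card = ∑ i, (E i).toFinset.card := by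
    rw [← Finset.card_biUnion]
    · congr 1
      ext e
      simp [← hE.iUnion_eq]
    · intro i _ j _ hij
      simpa using hE.disjoint i j hij
  have hdeg : d * Fintype.card V = ∑ i, 2 * (E i).toFinset.card := by
    rw [← Finset.mul_sum, ← hcard, ← G.sum_degrees_eq_twice_card_edges]
    simp [hG.degree_eq, mul_comm]
  have hle : ∀ i, 2 * (E i).toFinset.card ≤ Fintype.card V := fun i => by
    rw [(hmatch i).two_mul_card_eq]
    exact Finset.card_le_univ _
  have hV : 0 < Fintype.card V := Fintype.card_pos
  have hp : 0 < p := by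
    rcases Nat.eq_zero_or_pos p with rfl | h
    · simp at hdeg
      omega
    · exact h
  obtain ⟨v, hv⟩ : ∃ v, ∀ e ∈ E ⟨0, hp⟩, v ∉ e := by
    have h := hE.positive ⟨0, hp⟩
    have h0 : (⋃ (j : Fin p) (_ : j < ⟨0, hp⟩), E j) = ∅ := by
      simp [Fin.lt_def]
    rw [h0, deleteEdges_empty] at h
    exact h.exists_not_covered hd hG
  have hlt : ∑ i, 2 * (E i).toFinset.card < ∑ _i : Fin p, Fintype.card V := by
    refine Finset.sum_lt_sum (fun i _ => hle i) ⟨⟨0, hp⟩, Finset.mem_univ _, ?_⟩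
    rw [(hmatch _).two_mul_card_eq]
    refine Finset.card_lt_univ_of_notMem (x := v) ?_
    simpa using hv
  rw [← hdeg, Finset.sum_const, Finset.card_univ, Fintype.card_fin, smul_eq_mul] at hlt
  exact absurd (Nat.mul_le_mul_right _ hpd) (not_le.2 hlt)

/-! ### The torus and its tables -/

theorem cycleGraph_adj_iff_add_one {m : ℕ} [NeZero m] (hm : 3 ≤ m) (u v : Fin m) :
    (cycleGraph m).Adj u v ↔ v = u + 1 ∨ u = v + 1 := by
  obtain ⟨k, rfl⟩ : ∃ k, m = k + 2 := ⟨m - 2, by omega⟩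
  rw [cycleGraph_adj, sub_eq_iff_eq_add', sub_eq_iff_eq_add', add_comm v, add_comm u, or_comm,
    add_comm 1, add_comm 1]

theorem boxProd_cycleGraph_isRegularOfDegree {m n : ℕ} (hm : 3 ≤ m) (hn : 3 ≤ n)
    [(boxProd (cycleGraph m) (cycleGraph n)).LocallyFinite] :
    (boxProd (cycleGraph m) (cycleGraph n)).IsRegularOfDegree 4 := by
  obtain ⟨a, rfl⟩ : ∃ a, m = a + 3 := ⟨m - 3, by omega⟩
  obtain ⟨b, rfl⟩ : ∃ b, n = b + 3 := ⟨n - 3, by omega⟩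
  intro x
  rw [degree_boxProd, cycleGraph_degree_three_le, cycleGraph_degree_three_le]

/-- The arcs of the torus `C_m □ C_n`: `Sum.inl v` leads from `v` one step forward in the first
coordinate, `Sum.inr v` one step forward in the second; the value is the underlying edge. -/
def torusEdge (m n : ℕ) [NeZero m] [NeZero n] :
    (Fin m × Fin n) ⊕ (Fin m × Fin n) → Sym2 (Fin m × Fin n)
  | Sum.inl v => s(v, (v.1 + 1, v.2))
  | Sum.inr v => s(v, (v.1, v.2 + 1))

theorem _root_.Fin.add_one_ne_self {m : ℕ} [NeZero m] (hm : 3 ≤ m) (i : Fin m) : i + 1 ≠ i := by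
  obtain ⟨k, rfl⟩ : ∃ k, m = k + 2 := ⟨m - 2, by omega⟩
  simp

theorem _root_.Fin.add_one_add_one_ne_self {m : ℕ} [NeZero m] (hm : 3 ≤ m) (i : Fin m) :
    i + 1 + 1 ≠ i := by
  obtain ⟨k, rfl⟩ : ∃ k, m = k + 3 := ⟨m - 3, by omega⟩
  rw [add_assoc, ne_eq, add_eq_left]
  intro h
  have h2 := congrArg Fin.val h
  rw [Fin.val_add, Fin.val_one, Fin.val_zero, Nat.mod_eq_of_lt (by omega)] at h2
  omega

theorem torusEdge_injective {m n : ℕ} [NeZero m] [NeZero n] (hm : 3 ≤ m) (hn : 3 ≤ n) :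
    Function.Injective (torusEdge m n) := by
  have h1 := Fin.add_one_ne_self hm
  have h2 := Fin.add_one_ne_self hn
  have h3 := Fin.add_one_add_one_ne_self hm
  have h4 := Fin.add_one_add_one_ne_self hn
  rintro (⟨a, b⟩ | ⟨a, b⟩) (⟨a', b'⟩ | ⟨a', b'⟩) h <;>
    simp only [torusEdge, Sym2.eq_iff, Prod.mk.injEq, Sum.inl.injEq, Sum.inr.injEq] at h ⊢ <;>
    grind

theorem range_torusEdge {m n : ℕ} [NeZero m] [NeZero n] (hm : 3 ≤ m) (hn : 3 ≤ n) :
    Set.range (torusEdge m n) = (boxProd (cycleGraph m) (cycleGraph n)).edgeSet := by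
  ext e
  induction e with | _ u v
  obtain ⟨a, b⟩ := u
  obtain ⟨a', b'⟩ := v
  simp only [Set.mem_range, Sum.exists, torusEdge, mem_edgeSet, boxProd_adj,
    cycleGraph_adj_iff_add_one hm, cycleGraph_adj_iff_add_one hn, Sym2.eq_iff, Prod.exists,
    Prod.mk.injEq]
  grind

/-- A table of labels on the grid `Fin P × Fin Q`: the colours of the edges leaving a cell in the
first and in the second coordinate, and, for each colour, a weight of the cell. -/
structure TorusTable (k P Q : ℕ) where
  fst : Fin P → Fin Q → Fin k
  snd : Fin P → Fin Q → Fin k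
  weight : Fin k → Fin P → Fin Q → ℤ

/-- The table `T` is compatible with the digraphs `A` and `B` of possible steps in the first and in
the second index: the colours of the (up to four) edges at a cell are distinct, whichever steps lead
to the cell and away from it, and for each edge the weight of its own colour is positive and the
weights of all smaller colours are nonpositive. The colour of an edge depends only on the cell that
it leaves, not on the one that it enters. -/
structure TorusTable.Compatible {k P Q : ℕ} (T : TorusTable k P Q) (A : Fin P → Fin P → Prop)
    (B : Fin Q → Fin Q → Prop) : Prop where
  cross : ∀ p q, T.fst p q ≠ T.snd p q
  fst_fst : ∀ p p', A p p' → ∀ q, T.fst p q ≠ T.fst p' q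
  fst_snd : ∀ p p', A p p' → ∀ q, T.fst p q ≠ T.snd p' q
  snd_snd : ∀ q q', B q q' → ∀ p, T.snd p q ≠ T.snd p q'
  snd_fst : ∀ q q', B q q' → ∀ p, T.snd p q ≠ T.fst p q'
  snd_fst' : ∀ p p', A p p' → ∀ q q', B q q' → T.fst p q' ≠ T.snd p' q
  fst_pos : ∀ p p', A p p' → ∀ q,
    0 < T.weight (T.fst p q) p q + T.weight (T.fst p q) p' q
  fst_nonpos : ∀ p p', A p p' → ∀ q, ∀ i < T.fst p q, T.weight i p q + T.weight i p' q ≤ 0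
  snd_pos : ∀ q q', B q q' → ∀ p,
    0 < T.weight (T.snd p q) p q + T.weight (T.snd p q) p q'
  snd_nonpos : ∀ q q', B q q' → ∀ p, ∀ i < T.snd p q, T.weight i p q + T.weight i p q' ≤ 0

/-- Pulling back a compatible table along closed walks `x` and `y` gives a decomposition. -/
theorem exists_isPMD_of_torusTable {m n k P Q : ℕ} [NeZero m] [NeZero n] (hm : 3 ≤ m) (hn : 3 ≤ n)
    {T : TorusTable k P Q} {A : Fin P → Fin P → Prop} {B : Fin Q → Fin Q → Prop}
    (hT : T.Compatible A B) {x : Fin m → Fin P} {y : Fin n → Fin Q}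
    (hx : ∀ i, A (x i) (x (i + 1))) (hy : ∀ j, B (y j) (y (j + 1)))
    (hc : ∀ c, ∃ i j, T.fst (x i) (y j) = c ∨ T.snd (x i) (y j) = c) :
    ∃ E : Fin k → Set (Sym2 (Fin m × Fin n)),
      (boxProd (cycleGraph m) (cycleGraph n)).IsPMD E := by
  refine ⟨_, isPMD_of_arcColouring _ (torusEdge m n) (torusEdge_injective hm hn)
    (range_torusEdge hm hn)
    (Sum.elim (fun v => T.fst (x v.1) (y v.2)) (fun v => T.snd (x v.1) (y v.2))) ?_ ?_
    (fun i v => (T.weight i (x v.1) (y v.2) : ℝ)) ?_ ?_⟩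
  · intro c
    obtain ⟨i, j, h | h⟩ := hc c
    · exact ⟨Sum.inl (i, j), h⟩
    · exact ⟨Sum.inr (i, j), h⟩
  · have e1 := hT.cross
    have e2 := fun i => hT.fst_fst _ _ (hx i)
    have e3 := fun i => hT.fst_snd _ _ (hx i)
    have e4 := fun j => hT.snd_snd _ _ (hy j)
    have e5 := fun j => hT.snd_fst _ _ (hy j)
    have e6 := fun i j => hT.snd_fst' _ _ (hx i) _ _ (hy j)
    rintro (⟨a, b⟩ | ⟨a, b⟩) (⟨a', b'⟩ | ⟨a', b'⟩) hne hcol ⟨r, s⟩ ⟨h, h'⟩ <;>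
      simp only [torusEdge, Sym2.mem_iff, Prod.mk.injEq, Sum.elim_inl, Sum.elim_inr,
        ne_eq, Sum.inl.injEq, Sum.inr.injEq] at hne hcol h h'
    · have := add_left_injective (1 : Fin m)
      grind [Function.Injective]
    · grind
    · grind
    · have := add_left_injective (1 : Fin n)
      grind [Function.Injective]
  · rintro (⟨a, b⟩ | ⟨a, b⟩) u v h <;>
      simp only [torusEdge, Sym2.eq_iff] at h <;>
      obtain ⟨rfl, rfl⟩ | ⟨rfl, rfl⟩ := h <;>
      simp only [Sum.elim_inl, Sum.elim_inr]
    · exact_mod_cast hT.fst_pos _ _ (hx _) _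
    · rw [add_comm]
      exact_mod_cast hT.fst_pos _ _ (hx _) _
    · exact_mod_cast hT.snd_pos _ _ (hy _) _
    · rw [add_comm]
      exact_mod_cast hT.snd_pos _ _ (hy _) _
  · rintro (⟨a, b⟩ | ⟨a, b⟩) u v i h hi <;>
      simp only [torusEdge, Sym2.eq_iff] at h <;>
      obtain ⟨rfl, rfl⟩ | ⟨rfl, rfl⟩ := h <;>
      simp only [Sum.elim_inl, Sum.elim_inr] at hi ⊢
    · exact_mod_cast hT.fst_nonpos _ _ (hx _) _ i hi
    · rw [add_comm]
      exact_mod_cast hT.fst_nonpos _ _ (hx _) _ i hi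
    · exact_mod_cast hT.snd_nonpos _ _ (hy _) _ i hi
    · rw [add_comm]
      exact_mod_cast hT.snd_nonpos _ _ (hy _) _ i hi

/-- The digraph with arcs `p → p + 1` and arcs `l - 1 → 0` closing a cycle of length `l`, for each
`l` in the list `L`. -/
def ReturnArc (L : List ℕ) {P : ℕ} (p p' : Fin P) : Prop :=
  p'.val = p.val + 1 ∨ p'.val = 0 ∧ p.val + 1 ∈ L

instance (L : List ℕ) {P : ℕ} : DecidableRel (ReturnArc L (P := P)) :=
  fun _ _ => inferInstanceAs (Decidable (_ ∨ _))

/-- A closed walk of length `m = s + b * t`, once around the cycle of length `s` and then `t` times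
around that of length `b`. It starts with the states `0`, `1`, `2`. -/
theorem exists_closedWalk_returnArc {L : List ℕ} {P s b t m : ℕ} [NeZero m]
    (hL : ∀ l ∈ L, 3 ≤ l ∧ l ≤ P) (hs : s ∈ L) (hb : b ∈ L) (hm : m = s + b * t) :
    ∃ x : Fin m → Fin P, (∀ i, ReturnArc L (x i) (x (i + 1))) ∧
      ∀ i, i.val < 3 → (x i).val = i.val := by
  obtain ⟨hs3, hsP⟩ := hL s hs
  obtain ⟨hb3, hbP⟩ := hL b hb
  have hmod : ∀ r, r % b < b := fun r => Nat.mod_lt r (by omega)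
  have hstep : ∀ r, r % b + 1 = b ∧ (r + 1) % b = 0 ∨ (r + 1) % b = r % b + 1 := by
    intro r
    rw [← Nat.mod_add_mod r b 1]
    rcases Nat.lt_or_ge (r % b + 1) b with h | h
    · exact Or.inr (Nat.mod_eq_of_lt h)
    · have h' : r % b + 1 = b := le_antisymm (hmod r) h
      exact Or.inl ⟨h', by rw [h', Nat.mod_self]⟩
  -- The walk, as a function of time.
  set f : ℕ → ℕ := fun i => if i < s then i else (i - s) % b with hf
  have hfP : ∀ i, f i < P := by
    intro i
    have := hmod (i - s)
    simp only [hf]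
    split_ifs <;> omega
  have hwalk : ∀ i, f (i + 1) = f i + 1 ∨ f (i + 1) = 0 ∧ f i + 1 ∈ L := by
    intro i
    rcases lt_trichotomy (i + 1) s with h | h | h
    · simp [hf, h, (Nat.lt_succ_self i).trans h]
    · have hi : i < s := by omega
      simp [hf, h, hi, hs]
    · have hi : ¬ i < s := by omega
      have hi' : ¬ i + 1 < s := by omega
      simp only [hf, hi, hi', if_false, Nat.sub_add_comm (not_lt.1 hi)]
      rcases hstep (i - s) with ⟨h1, h2⟩ | h1
      · exact Or.inr ⟨h2, h1.symm ▸ hb⟩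
      · exact Or.inl h1
  have hclose : ∀ i, i + 1 = m → f i + 1 ∈ L := by
    intro i hi
    rcases Nat.eq_zero_or_pos t with rfl | ht
    · have hi' : i < s := by omega
      simp only [hf, hi', if_true]
      rwa [hi, hm, mul_zero, add_zero]
    · have hbt : b ≤ b * t := Nat.le_mul_of_pos_right b ht
      have hi' : ¬ i < s := by omega
      simp only [hf, hi', if_false]
      have hr : i - s + 1 = b * t := by omega
      rcases hstep (i - s) with ⟨h1, -⟩ | h1
      · rwa [h1]
      · rw [hr, Nat.mul_mod_right] at h1
        omega
  refine ⟨fun i => ⟨f i, hfP i⟩, fun i => ?_, fun i hi => ?_⟩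
  · have hone : (i + 1).val = (i.val + 1) % m := by
      rw [Fin.val_add, Fin.val_one', Nat.add_mod_mod]
    have hi := i.isLt
    simp only [ReturnArc, hone]
    rcases Nat.lt_or_ge (i.val + 1) m with hlt | hge
    · rw [Nat.mod_eq_of_lt hlt]
      exact hwalk i
    · have him : i.val + 1 = m := by omega
      rw [him, Nat.mod_self]
      have hs0 : 0 < s := by omega
      exact Or.inr ⟨by simp [hf, hs0], hclose i him⟩
  · simp [hf, hi.trans_le hs3]

/-- The hypothesis `hc`, that every colour occurs on an edge leaving one of the cells common to all
pullbacks, makes the parts nonempty. -/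
theorem TorusTable.Compatible.exists_isPMD {m n k P Q : ℕ} {L L' : List ℕ} {T : TorusTable k P Q}
    (hT : T.Compatible (ReturnArc L) (ReturnArc L'))
    (hc : ∀ c, ∃ p q, p.val < 3 ∧ q.val < 3 ∧ (T.fst p q = c ∨ T.snd p q = c))
    (hL : ∀ l ∈ L, 3 ≤ l ∧ l ≤ P) (hL' : ∀ l ∈ L', 3 ≤ l ∧ l ≤ Q)
    (hm : ∃ s ∈ L, ∃ b ∈ L, ∃ t, m = s + b * t) (hn : ∃ s ∈ L', ∃ b ∈ L', ∃ t, n = s + b * t) :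
    ∃ E : Fin k → Set (Sym2 (Fin m × Fin n)),
      (boxProd (cycleGraph m) (cycleGraph n)).IsPMD E := by
  obtain ⟨s, hs, b, hb, t, hm⟩ := hm
  obtain ⟨s', hs', b', hb', t', hn⟩ := hn
  have hm3 : 3 ≤ m := by have := hL s hs; omega
  have hn3 : 3 ≤ n := by have := hL' s' hs'; omega
  have : NeZero m := ⟨by omega⟩
  have : NeZero n := ⟨by omega⟩
  obtain ⟨x, hx, hx3⟩ := exists_closedWalk_returnArc hL hs hb hm
  obtain ⟨y, hy, hy3⟩ := exists_closedWalk_returnArc hL' hs' hb' hn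
  refine exists_isPMD_of_torusTable hm3 hn3 hT hx hy fun c => ?_
  obtain ⟨p, q, hp, hq, h⟩ := hc c
  have hxp : x ⟨p, by omega⟩ = p := Fin.ext (hx3 _ hp)
  have hyq : y ⟨q, by omega⟩ = q := Fin.ext (hy3 _ hq)
  exact ⟨_, _, by rwa [hxp, hyq]⟩

/-- The table with the two coordinates exchanged. -/
def TorusTable.transpose {k P Q : ℕ} (T : TorusTable k P Q) : TorusTable k Q P where
  fst q p := T.snd p q
  snd q p := T.fst p q
  weight c q p := T.weight c p q

theorem TorusTable.Compatible.transpose {k P Q : ℕ} {T : TorusTable k P Q}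
    {A : Fin P → Fin P → Prop} {B : Fin Q → Fin Q → Prop} (h : T.Compatible A B) :
    T.transpose.Compatible B A where
  cross q p := (h.cross p q).symm
  fst_fst := h.snd_snd
  fst_snd := h.snd_fst
  snd_snd := h.fst_fst
  snd_fst := h.fst_snd
  snd_fst' q q' hq p p' hp := (h.snd_fst' p p' hp q q' hq).symm
  fst_pos := h.snd_pos
  fst_nonpos := h.snd_nonpos
  snd_pos := h.fst_pos
  snd_nonpos := h.fst_nonpos

/-! ### The two tables -/

/-- A six-colour table in which both indices may run through cycles of lengths `3`, `4` and `5`. The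
constant weight `1` serves for the last colour, as no edges of later colours are left. -/
def sixColourTable : TorusTable 6 5 5 where
  fst :=
    ![![3, 0, 5, 1, 5],
      ![5, 2, 1, 5, 1],
      ![2, 4, 2, 3, 2],
      ![1, 2, 3, 2, 3],
      ![2, 4, 2, 5, 1]]
  snd :=
    ![![5, 1, 4, 0, 4],
      ![1, 3, 4, 2, 4],
      ![3, 5, 0, 4, 0],
      ![0, 5, 4, 5, 4],
      ![3, 5, 0, 4, 0]]
  weight :=
    ![![![-2, 0, -4, 3, -2],
        ![-1, 1, -4, -3, -2],
        ![-1, -4, 4, -3, 2],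
        ![1, 0, -4, -3, -2],
        ![-1, -4, 4, -3, 2]],
      ![![-3, 3, -2, 1, -2],
        ![0, 1, -1, 0, 0],
        ![-4, -3, 2, -1, 1],
        ![4, -4, -4, -4, -4],
        ![0, -3, 0, -3, 3]],
      ![![0, 0, 0, -1, -2],
        ![-3, 4, -4, 4, 1],
        ![3, -3, 3, -4, 4],
        ![-2, 2, -2, 2, -3],
        ![1, -1, 1, -1, -4]],
      ![![-1, -4, -1, 1, 1],
        ![2, 4, -3, -3, -2],
        ![-3, 4, -4, 3, -3],
        ![-2, -4, 2, -2, 0],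
        ![3, -2, 2, -3, 1]],
      ![![3, -3, -2, 3, -1],
        ![0, 1, 2, -1, 1],
        ![0, 4, -4, 1, 2],
        ![0, -2, 2, -1, 1],
        ![4, 4, -4, -3, 4]],
      fun _ _ => 1]

/-- A five-colour table in which the first index may run through cycles of lengths `3`, `5` and `7`,
the second through cycles of lengths `4` and `6`. -/
def fiveColourTable : TorusTable 5 7 6 where
  fst :=
    ![![0, 1, 0, 1, 2, 1],
      ![3, 3, 2, 2, 0, 2],
      ![1, 2, 3, 0, 1, 0],
      ![0, 1, 0, 1, 0, 1],
      ![1, 2, 3, 0, 1, 2],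
      ![2, 1, 1, 3, 2, 1],
      ![1, 2, 3, 0, 1, 2]]
  snd :=
    ![![3, 4, 2, 4, 3, 4],
      ![2, 4, 3, 4, 3, 4],
      ![0, 4, 1, 4, 3, 4],
      ![3, 4, 2, 4, 3, 4],
      ![3, 4, 2, 4, 3, 4],
      ![3, 0, 2, 4, 3, 0],
      ![3, 4, 2, 4, 3, 4]]
  weight :=
    ![![![-2, -4, -2, 2, -3, 0],
        ![3, -4, 3, -3, 3, -3],
        ![-3, 4, -4, 2, -2, 2],
        ![1, -4, 1, -1, 1, -1],
        ![0, -2, 0, 0, 0, -3],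
        ![-2, 2, -1, 1, -3, 3],
        ![1, -2, 1, -1, 0, -3]],
      ![![2, -2, -4, -2, 2, -3],
        ![-4, 3, -4, 3, -4, 4],
        ![3, -4, 4, -3, 3, -4],
        ![-2, 2, -4, 2, -2, 2],
        ![1, -1, -3, -1, 1, -1],
        ![0, 0, 2, -2, 0, 0],
        ![-1, 1, -1, 0, -1, 1]],
      ![![-4, 1, -1, 2, -2, 1],
        ![2, -1, 1, -3, 3, -3],
        ![-4, 0, 0, 4, -4, 4],
        ![-3, 2, -2, 3, -4, 3],
        ![-4, 3, -3, 4, -4, 3],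
        ![2, -2, 3, -2, 2, -2],
        ![-1, 0, 0, 1, -1, 1]],
      ![![3, -2, 2, -4, 4, -3],
        ![-2, 0, 0, 1, -1, 2],
        ![3, 1, -1, -4, 4, -3],
        ![3, -2, 2, -4, 4, -3],
        ![3, -2, 2, -4, 4, -3],
        ![-2, 3, -1, 2, -2, 3],
        ![0, 1, -1, -1, 1, 0]],
      fun _ _ => 1]

theorem sixColourTable_compatible :
    sixColourTable.Compatible (ReturnArc [3, 4, 5]) (ReturnArc [3, 4, 5]) := by
  constructor <;> decide +kernel

theorem fiveColourTable_compatible :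
    fiveColourTable.Compatible (ReturnArc [3, 5, 7]) (ReturnArc [4, 6]) := by
  constructor <;> decide +kernel

theorem exists_isPMD_six {m n : ℕ} (hm : 3 ≤ m) (hn : 3 ≤ n) :
    ∃ E : Fin 6 → Set (Sym2 (Fin m × Fin n)),
      (boxProd (cycleGraph m) (cycleGraph n)).IsPMD E := by
  have key : ∀ m : ℕ, 3 ≤ m → ∃ s ∈ [3, 4, 5], ∃ b ∈ [3, 4, 5], ∃ t, m = s + b * t := by
    intro m hm
    refine ⟨3 + m % 3, ?_, 3, by simp, m / 3 - 1, by omega⟩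
    have := Nat.mod_lt m (show 3 > 0 by omega)
    simp only [List.mem_cons, List.not_mem_nil, or_false]
    omega
  exact sixColourTable_compatible.exists_isPMD (by decide +kernel) (by simp) (by simp)
    (key m hm) (key n hn)

theorem exists_isPMD_five {m n : ℕ} (hm : 3 ≤ m) (hn : 3 ≤ n) (hmn : Odd (m + n)) :
    ∃ E : Fin 5 → Set (Sym2 (Fin m × Fin n)),
      (boxProd (cycleGraph m) (cycleGraph n)).IsPMD E := by
  have hodd : ∀ m : ℕ, 3 ≤ m → Odd m → ∃ s ∈ [3, 5, 7], ∃ b ∈ [3, 5, 7], ∃ t, m = s + b * t := by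
    rintro m hm ⟨r, rfl⟩
    obtain h | h | h : r % 3 = 0 ∨ r % 3 = 1 ∨ r % 3 = 2 := by omega
    · exact ⟨7, by simp, 3, by simp, (2 * r + 1) / 3 - 2, by omega⟩
    · exact ⟨3, by simp, 3, by simp, (2 * r + 1) / 3 - 1, by omega⟩
    · exact ⟨5, by simp, 3, by simp, (2 * r + 1) / 3 - 1, by omega⟩
  have heven : ∀ n : ℕ, 3 ≤ n → Even n → ∃ s ∈ [4, 6], ∃ b ∈ [4, 6], ∃ t, n = s + b * t := by
    rintro n hn ⟨r, rfl⟩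
    obtain h | h : r % 2 = 0 ∨ r % 2 = 1 := by omega
    · exact ⟨4, by simp, 4, by simp, r / 2 - 1, by omega⟩
    · exact ⟨6, by simp, 4, by simp, r / 2 - 1, by omega⟩
  rcases Nat.even_or_odd m with he | ho
  · exact fiveColourTable_compatible.transpose.exists_isPMD (by decide +kernel) (by simp) (by simp)
      (heven m hm he) (hodd n hn ((Nat.odd_add'.1 hmn).2 he))
  · exact fiveColourTable_compatible.exists_isPMD (by decide +kernel) (by simp) (by simp)
      (hodd m hm ho) (heven n hn ((Nat.odd_add.1 hmn).1 ho))

/-! ### The positive matching decomposition number -/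

theorem pmd_le {V : Type*} {G : SimpleGraph V} {p : ℕ} (h : ∃ E : Fin p → Set (Sym2 V), G.IsPMD E) :
    G.pmd ≤ p :=
  Nat.sInf_le h

/-- The existence of some decomposition is needed because the infimum of the empty set is `0`. -/
theorem lt_pmd_of_isRegularOfDegree {V : Type*} [Fintype V] [Nonempty V] {G : SimpleGraph V}
    [DecidableRel G.Adj] {d p : ℕ} (hd : 2 ≤ d) (hG : G.IsRegularOfDegree d)
    (h : ∃ E : Fin p → Set (Sym2 V), G.IsPMD E) : d < G.pmd := by
  obtain ⟨E, hE⟩ := Nat.sInf_mem (s := {p : ℕ | ∃ E : Fin p → Set (Sym2 V), G.IsPMD E}) ⟨p, h⟩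
  exact hE.degree_lt hd hG

theorem five_le_pmd_boxProd_cycleGraph {m n : ℕ} (hm : 3 ≤ m) (hn : 3 ≤ n) :
    5 ≤ (boxProd (cycleGraph m) (cycleGraph n)).pmd := by
  classical
  have : NeZero m := ⟨by omega⟩
  have : NeZero n := ⟨by omega⟩
  refine lt_pmd_of_isRegularOfDegree (d := 4) (by norm_num) ?_ (exists_isPMD_six hm hn)
  -- The two sides may carry different instances of local finiteness.
  convert boxProd_cycleGraph_isRegularOfDegree hm hn

end SimpleGraph

theorem mainTheorem1 (m n : ℕ) (hm : 3 ≤ m) (hn : 3 ≤ n) :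
    (5 ≤ (SimpleGraph.boxProd (SimpleGraph.cycleGraph m) (SimpleGraph.cycleGraph n)).pmd ∧
      (SimpleGraph.boxProd (SimpleGraph.cycleGraph m) (SimpleGraph.cycleGraph n)).pmd ≤ 6) ∧
    (Odd (m + n) →
      ({m, n} : Finset ℕ) ≠ {3, 4} → ({m, n} : Finset ℕ) ≠ {3, 6} →
      ({m, n} : Finset ℕ) ≠ {5, 6} →
      (SimpleGraph.boxProd (SimpleGraph.cycleGraph m) (SimpleGraph.cycleGraph n)).pmd = 5) := by
  refine ⟨⟨SimpleGraph.five_le_pmd_boxProd_cycleGraph hm hn,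
    SimpleGraph.pmd_le (SimpleGraph.exists_isPMD_six hm hn)⟩, fun hodd _ _ _ => ?_⟩
  exact le_antisymm (SimpleGraph.pmd_le (SimpleGraph.exists_isPMD_five hm hn hodd))
    (SimpleGraph.five_le_pmd_boxProd_cycleGraph hm hn)
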